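/- **Setting.** Let $G=(V,E)$ be a finite graph without loops (parallel edges are allowed), whose edges $e\in E$ operate independently with probabilities $p(e)\in[0,1]$. For $F\subseteq E$ let $\Pr(F)=\prod_{e\in F}p(e)\prod_{e\in E\setminus F}(1-p(e))$. For a set $K\subseteq V$ of terminal vertices, the $K$-terminal reliability is $$R(G,K)=\sum_{F\subseteq E}[\text{all vertices of }K\text{ are mutually connected in }(V,F)]\,\Pr(F),$$ where $[\cdot]$ is $1$ if the condition holds and $0$ otherwise; the same definition is used for other graphs with edges from $E$. Let $|K|\ge 2$, and let $(G^1,G^2,X)$ be a $K$-splitting of $(G,K)$: $G^1=(V^1,E^1)$ and $G^2=(V^2,E^2)$ are subgraphs of $G$ with $E^1\cup E^2=E$, $E^1\cap E^2=\emptyset$, $V^1\cup V^2=V$, $V^1\cap V^2=X$, such that $K^1=V^1\cap K$ and $K^2=V^2\cap K$ are both non-empty. **Labelled set partitions.** A labelled set partition of $X$ is a set partition of $X$ in which each block is either labelled or unlabelled. Write $\sigma\le\pi$ if every block of $\sigma$ is contained in a block of $\pi$, which must be labelled if the block of $\sigma$ is labelled. This defines a finite lattice $\Pi_l(X)$ with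 join $\vee$ and Möbius function $\mu$. Put $m(\pi)=1$ if $\pi$ has exactly one labelled block and $m(\pi)=0$ otherwise. Let $\pi_X$ be the partition of $X$ into singletons in which $\{x\}$ is labelled if and only if $x\in K$, and let $\Pi_l(X,\pi_X)$ be the set of all $\pi\ge\pi_X$ with at least one labelled block. For $\pi\in\Pi_l(X,\pi_X)$ put $$\lambda(\pi)=\sum_{\sigma\in\Pi_l(X,\pi_X),\ \sigma\ge\pi}\mu(\pi,\sigma)\,m(\sigma),\qquad \Pi_l(X,\pi_X)_0=\{\pi\in\Pi_l(X,\pi_X):\lambda(\pi)\neq0\}.$$ **Merging.** For $\pi\in\Pi_l(X)$ let $G^i_\pi$ be the graph obtained from $G^i$ by merging all vertices in a common block of $\pi$ into a single vertex (which is identified with this block), removing the edges whose two ends lie in a common block and keeping parallel edges. Its terminal set $K^i_\pi$ consists of the vertices in $K^i\setminus X$ and of all blocks of $\pi$ that are labelled or contain a vertex of $K^i$. Every edge keeps its probability. **Theorem (symmetric splitting formula).** Let $\mathbf M_0=(m(\pi\vee\sigma))_{\pi,\sigma\in\Pi_l(X,\pi_X)_0}$ and $\mathbf r_0(G^i)=(R(G^i_\pi,K^i_\pi))_{\pi\in\Pi_l(X,\pi_X)_0}$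 for $i=1,2$. Then the matrix $\mathbf M_0$ is invertible, and $$R(G,K)=\mathbf r_0(G^1)^T\,\mathbf M_0^{-1}\,\mathbf r_0(G^2).$$ -/

import Mathlib

/-- A labelled set partition of `X`, given by its equivalence relation `rel` (the blocks are the
equivalence classes) together with the union `labelled` of its labelled blocks, that is, a set of
points which is a union of blocks. -/
@[ext]
structure LabelledPartition (X : Type*) where
  /-- The equivalence relation whose classes are the blocks. -/
  rel : Setoid X
  /-- The set of points that lie in a labelled block. -/
  labelled : Set X
  /-- Each block is labelled or unlabelled as a whole. -/
  saturated : ∀ x y, rel x y → x ∈ labelled → y ∈ labelled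

namespace LabelledPartition

variable {X : Type*}

/-- The blocks (without their labels). -/
def blocks (π : LabelledPartition X) : Set (Set X) := π.rel.classes

/-- The labelled blocks. -/
def labelledBlocks (π : LabelledPartition X) : Set (Set X) := {B ∈ π.blocks | B ⊆ π.labelled}

/-- The block containing `x`. -/
def blockOf (π : LabelledPartition X) (x : X) : Set X := {y | π.rel y x}

/-- `σ ≤ π` if every block of `σ`, together with its label if it has one, is contained in a
block of `π` (with its label). -/
instance : LE (LabelledPartition X) where
  le σ π := ∀ B ∈ σ.blocks, ∃ C ∈ π.blocks,
    B ⊆ C ∧ (B ∈ σ.labelledBlocks → C ∈ π.labelledBlocks)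

theorem blockOf_mem (π : LabelledPartition X) (x : X) : π.blockOf x ∈ π.blocks :=
  π.rel.mem_classes x

theorem blockOf_mem_labelledBlocks (π : LabelledPartition X) {x : X} (hx : x ∈ π.labelled) :
    π.blockOf x ∈ π.labelledBlocks :=
  ⟨π.blockOf_mem x, fun _ hy => π.saturated _ _ (π.rel.symm' hy) hx⟩

theorem le_iff {σ π : LabelledPartition X} :
    σ ≤ π ↔ σ.rel ≤ π.rel ∧ σ.labelled ⊆ π.labelled := by
  constructor
  · intro h
    refine ⟨fun x y hxy => ?_, fun x hx => ?_⟩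
    · obtain ⟨C, hC, hBC, -⟩ := h _ (σ.blockOf_mem y)
      exact (Setoid.rel_iff_exists_classes _).2 ⟨C, hC, hBC hxy, hBC (σ.rel.refl' y)⟩
    · obtain ⟨C, -, hBC, hl⟩ := h _ (σ.blockOf_mem x)
      exact (hl (σ.blockOf_mem_labelledBlocks hx)).2 (hBC (σ.rel.refl' x))
  · rintro ⟨hr, hl⟩ B ⟨y, rfl⟩
    refine ⟨π.blockOf y, π.blockOf_mem y, fun x hx => hr hx, fun hB => ?_⟩
    exact π.blockOf_mem_labelledBlocks (hl (hB.2 (σ.rel.refl' y)))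

instance : PartialOrder (LabelledPartition X) where
  le_refl π := le_iff.2 ⟨le_refl _, subset_rfl⟩
  le_trans _ _ _ h h' :=
    le_iff.2 ⟨(le_iff.1 h).1.trans (le_iff.1 h').1, (le_iff.1 h).2.trans (le_iff.1 h').2⟩
  le_antisymm _ _ h h' := LabelledPartition.ext
    (le_antisymm (le_iff.1 h).1 (le_iff.1 h').1)
    (Set.Subset.antisymm (le_iff.1 h).2 (le_iff.1 h').2)

/-- The join: join the two partitions, and label each block that contains a labelled block of
one of them. -/
instance : SemilatticeSup (LabelledPartition X) where
  sup σ π :=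
    { rel := σ.rel ⊔ π.rel
      labelled := {y | ∃ x ∈ σ.labelled ∪ π.labelled, (σ.rel ⊔ π.rel) x y}
      saturated := fun _ _ hxy ⟨z, hz, hzx⟩ => ⟨z, hz, (σ.rel ⊔ π.rel).trans' hzx hxy⟩ }
  le_sup_left σ π := le_iff.2 ⟨le_sup_left, fun x hx => ⟨x, Or.inl hx, Setoid.refl' _ x⟩⟩
  le_sup_right σ π := le_iff.2 ⟨le_sup_right, fun x hx => ⟨x, Or.inr hx, Setoid.refl' _ x⟩⟩
  sup_le σ π τ h h' := by
    have hr : σ.rel ⊔ π.rel ≤ τ.rel := sup_le (le_iff.1 h).1 (le_iff.1 h').1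
    refine le_iff.2 ⟨hr, ?_⟩
    rintro y ⟨x, hx, hxy⟩
    exact τ.saturated _ _ (hr hxy) (hx.elim (fun k => (le_iff.1 h).2 k) (fun k => (le_iff.1 h').2 k))

instance [Finite X] : Finite (LabelledPartition X) :=
  Finite.of_injective (fun π : LabelledPartition X => (π.rel.classes, π.labelled))
    fun _ _ h => LabelledPartition.ext (Setoid.classes_inj.2 (Prod.ext_iff.1 h).1)
      (Prod.ext_iff.1 h).2

noncomputable instance [Finite X] : Fintype (LabelledPartition X) := Fintype.ofFinite _

noncomputable instance : DecidableEq (LabelledPartition X) := Classical.decEq _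

open Classical in
noncomputable instance [Finite X] : LocallyFiniteOrder (LabelledPartition X) :=
  Fintype.toLocallyFiniteOrder

open Classical in
/-- `m(π) = 1` if `π` has exactly one labelled block, and `m(π) = 0` otherwise. -/
noncomputable def m (π : LabelledPartition X) : ℝ :=
  if ∃! B, B ∈ π.labelledBlocks then 1 else 0

/-- The labelled set partition `π_X` into singletons in which precisely the singletons of the
elements of `T` are labelled. -/
def singletons (T : Set X) : LabelledPartition X where
  rel := ⊥
  labelled := T
  saturated x y h hx := by
    have h' : x = y := h
    exact h' ▸ hx

/-- The set `Π_l(X, ρ)` of the labelled set partitions `π ≥ ρ` with at least one labelled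
block. -/
def states (ρ : LabelledPartition X) : Set (LabelledPartition X) :=
  {π | ρ ≤ π ∧ π.labelledBlocks.Nonempty}

open Classical in
/-- `λ(π) = ∑ μ(π, σ) m(σ)`, the sum over all `σ ≥ π` in `Π_l(X, ρ)`, where `μ` is the Möbius
function of the lattice of all labelled set partitions of `X`. -/
noncomputable def lam [Finite X] (ρ π : LabelledPartition X) : ℝ :=
  ∑ σ : LabelledPartition X with σ ∈ ρ.states ∧ π ≤ σ, IncidenceAlgebra.mu ℝ π σ * σ.m

/-- The reduced state set `Π_l(X, ρ)₀` of all `π ∈ Π_l(X, ρ)` with `λ(π) ≠ 0`. -/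
def reducedStates [Finite X] (ρ : LabelledPartition X) : Set (LabelledPartition X) :=
  {π ∈ ρ.states | ρ.lam π ≠ 0}

noncomputable instance [Finite X] (ρ : LabelledPartition X) : Fintype ρ.reducedStates :=
  Fintype.ofFinite _

/-- The transfer matrix `(m(π ∨ σ))`, restricted to the reduced state set. -/
noncomputable def transferMatrix₀ [Finite X] (ρ : LabelledPartition X) :
    Matrix ρ.reducedStates ρ.reducedStates ℝ :=
  Matrix.of fun π σ => m (π.1 ⊔ σ.1)

end LabelledPartition

namespace Graph

variable {α β : Type*}

/-- `G` is `K`-connected if any two vertices of `K` are joined by a path in `G`. -/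
def KConnected (G : Graph α β) (K : Set α) : Prop :=
  ∀ u ∈ K, ∀ v ∈ K, Relation.ReflTransGen G.Adj u v

/-- The probability that exactly the edges in `F` are operating, if the edges `e` of `G` operate
independently with the probabilities `p e`. -/
noncomputable def edgeProb (G : Graph α β) (p : β → ℝ) (F : Set β) : ℝ :=
  (∏ᶠ e ∈ F, p e) * ∏ᶠ e ∈ G.edgeSet \ F, (1 - p e)

open Classical in
/-- The `K`-terminal reliability of a finite graph `G`: the sum, over all `F ⊆ E(G)` such that the
spanning subgraph with edge set `F` is `K`-connected, of the probability of that subgraph. -/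
noncomputable def reliability (G : Graph α β) (K : Set α) (p : β → ℝ) : ℝ :=
  ∑ᶠ F ∈ 𝒫 G.edgeSet, (if (G.restrict F).KConnected K then 1 else 0) * G.edgeProb p F

/-- `(G₁, G₂, X)` is a `K`-splitting of the `K`-graph `(G, K)`, where `G` is a finite graph
without loops (parallel edges are allowed). -/
structure IsKSplitting (G G₁ G₂ : Graph α β) (K : Set α) (X : Finset α) : Prop where
  finite_vertexSet : G.vertexSet.Finite
  finite_edgeSet : G.edgeSet.Finite
  loopless : G.Loopless
  terminals_subset : K ⊆ G.vertexSet
  two_le_terminals : 2 ≤ K.ncard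
  left_le : G₁ ≤ G
  right_le : G₂ ≤ G
  edgeSet_union : G₁.edgeSet ∪ G₂.edgeSet = G.edgeSet
  edgeSet_inter : G₁.edgeSet ∩ G₂.edgeSet = ∅
  vertexSet_union : G₁.vertexSet ∪ G₂.vertexSet = G.vertexSet
  vertexSet_inter : G₁.vertexSet ∩ G₂.vertexSet = (X : Set α)
  terminals_left : (G₁.vertexSet ∩ K).Nonempty
  terminals_right : (G₂.vertexSet ∩ K).Nonempty

variable {X : Finset α}

open Classical in
/-- The map that sends a vertex in `X` to its block in `π` and fixes all other vertices. -/
noncomputable def mergeMap (π : LabelledPartition X) (v : α) : α ⊕ Set X :=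
  if h : v ∈ X then Sum.inr (π.blockOf ⟨v, h⟩) else Sum.inl v

/-- The `π`-merging of `G`: the vertices in a common block of `π` are merged into one vertex,
namely this block, and the edges whose ends lie in a common block are removed. -/
noncomputable def merge (G : Graph α β) (π : LabelledPartition X) : Graph (α ⊕ Set X) β :=
  (G.map (mergeMap π)).restrict
    {e | ¬ ∃ B ∈ π.blocks, ∀ v, G.Inc e v → v ∈ Subtype.val '' B}

/-- The terminals of the `π`-merged graph: the terminals outside of `X` and all blocks of `π`
that are labelled or contain a terminal. -/
def mergeTerminals (K : Set α) (π : LabelledPartition X) : Set (α ⊕ Set X) :=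
  Sum.inl '' (K \ X) ∪
    Sum.inr '' {B ∈ π.blocks | B ∈ π.labelledBlocks ∨ (Subtype.val '' B ∩ K).Nonempty}

/-- The labelled set partition `π_X` of `X` into singletons, where `{x}` is labelled if and only
if `x ∈ K`. -/
def terminalPartition (K : Set α) (X : Finset α) : LabelledPartition X :=
  LabelledPartition.singletons {x : X | (x : α) ∈ K}

/-- The vector of the reliabilities of the `π`-merged `K`-graphs of `(H, V(H) ∩ K)`, where `π`
runs through the reduced state set. -/
noncomputable def relVector₀ (H : Graph α β) (K : Set α) (X : Finset α) (p : β → ℝ) :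
    (terminalPartition K X).reducedStates → ℝ :=
  fun π => (H.merge π.1).reliability (mergeTerminals (H.vertexSet ∩ K) π.1) p

end Graph

/-!
For an equivalence relation on the vertices together with a set of terminals, take the labelled
partition of `X` consisting of the traces of the classes, labelled when the class contains a
terminal (`LabelledPartition.induced`). Given operating edge sets `F₁` and `F₂` of the two sides,
all terminals of `G` are connected if and only if each terminal is connected to `X` within its own
side and the join of the two induced partitions has exactly one labelled block
(`LabelledPartition.ite_forall_rel_sup_eq`). Here it matters that both sides contain a terminal: a
component with a terminal that misses `X` is then cut off from some other terminal.

The same statement covers the merged graphs. Merging the blocks of `π` amounts to joining the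
connectivity relation of the side with the relation "equal or in a common block of `π`", and the
labelled partition induced by the latter, with the labelled points as terminals, is `π`
(`Graph.kConnected_merge_restrict_iff`, `Graph.induced_ker_mergeMap`).

By Möbius inversion on the upper set of states, `m π` is the sum of `λ τ` over the reduced states
`τ ≥ π` (`LabelledPartition.m_eq_sum_lam`). Since `π ⊔ σ ≤ τ` means `π ≤ τ` and `σ ≤ τ`, this gives
`M₀ = Z D Zᵀ` with the zeta matrix `Z` of the reduced states and `D = diag λ`; both are invertible,
hence so is `M₀`. With `bᵢ τ` the probability that all terminals of side `i` are attached to `X` and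
the induced partition is at most `τ`, the same expansion and the independence of the edges give
`r₀(Gⁱ) = Z D bᵢ` (`Graph.relVector₀_eq`) and `R(G, K) = b₁ᵀ D b₂`
(`Graph.IsKSplitting.reliability_eq`). Therefore `r₀(G¹)ᵀ M₀⁻¹ r₀(G²) = b₁ᵀ D b₂ = R(G, K)`.
-/

namespace LabelledPartition

variable {α X : Type*}

/-! ### Möbius inversion over the state set -/

theorem labelledBlocks_nonempty_iff (π : LabelledPartition X) :
    π.labelledBlocks.Nonempty ↔ π.labelled.Nonempty := by
  constructor
  · rintro ⟨B, ⟨x, rfl⟩, hB⟩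
    exact ⟨x, hB (π.rel.refl' x)⟩
  · rintro ⟨x, hx⟩
    exact ⟨_, π.blockOf_mem_labelledBlocks hx⟩

theorem blockOf_eq_blockOf_iff (π : LabelledPartition X) {x y : X} :
    π.blockOf x = π.blockOf y ↔ π.rel x y := by
  constructor
  · intro h
    have : x ∈ π.blockOf y := h ▸ π.rel.refl' x
    exact this
  · intro h
    ext z
    exact ⟨fun hz => π.rel.trans' hz h, fun hz => π.rel.trans' hz (π.rel.symm' h)⟩

theorem existsUnique_labelledBlock_iff (π : LabelledPartition X) :
    (∃! B, B ∈ π.labelledBlocks) ↔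
      π.labelled.Nonempty ∧ ∀ x ∈ π.labelled, ∀ y ∈ π.labelled, π.rel x y := by
  constructor
  · rintro ⟨B, hB, hu⟩
    refine ⟨π.labelledBlocks_nonempty_iff.1 ⟨B, hB⟩, fun x hx y hy => ?_⟩
    exact π.blockOf_eq_blockOf_iff.1 ((hu _ (π.blockOf_mem_labelledBlocks hx)).trans
      (hu _ (π.blockOf_mem_labelledBlocks hy)).symm)
  · rintro ⟨⟨x, hx⟩, h⟩
    refine ⟨π.blockOf x, π.blockOf_mem_labelledBlocks hx, ?_⟩
    rintro _ ⟨⟨y, rfl⟩, hB⟩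
    exact π.blockOf_eq_blockOf_iff.2 (h y (hB (π.rel.refl' y)) x hx)

theorem mem_states_of_le {ρ π σ : LabelledPartition X} (hπ : π ∈ ρ.states) (h : π ≤ σ) :
    σ ∈ ρ.states :=
  ⟨hπ.1.trans h, σ.labelledBlocks_nonempty_iff.2
    ((π.labelledBlocks_nonempty_iff.1 hπ.2).mono (le_iff.1 h).2)⟩

open Classical in
/-- Möbius inversion of the definition of `λ`. The states form an upper set, so that the sum over
the states above `π` is the sum over all labelled partitions above `π`. -/
theorem m_eq_sum_lam [Finite X] {ρ π : LabelledPartition X} (hπ : π ∈ ρ.states) :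
    π.m = ∑ τ : ρ.reducedStates, if π ≤ τ.1 then ρ.lam τ.1 else 0 := by
  have hlam : ∀ τ, π ≤ τ → ρ.lam τ =
      ∑ σ : LabelledPartition X, if τ ≤ σ then IncidenceAlgebra.mu ℝ τ σ * σ.m else 0 := by
    intro τ hτ
    rw [lam, ← Finset.sum_filter]
    refine Finset.sum_congr (Finset.filter_congr fun σ _ => ?_) fun _ _ => rfl
    exact ⟨fun h => h.2, fun h => ⟨mem_states_of_le hπ (hτ.trans h), h⟩⟩
  have hsub : ∑ τ : ρ.reducedStates, (if π ≤ τ.1 then ρ.lam τ.1 else 0) =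
      ∑ τ : LabelledPartition X, if π ≤ τ then ρ.lam τ else 0 := by
    rw [← Finset.sum_subset (Finset.subset_univ ρ.reducedStates.toFinset)]
    · exact (Finset.sum_subtype ρ.reducedStates.toFinset (fun _ => Set.mem_toFinset)
        fun τ => if π ≤ τ then ρ.lam τ else 0).symm
    · intro τ _ hτ
      split_ifs with h
      · by_contra hne
        exact hτ (Set.mem_toFinset.2 ⟨mem_states_of_le hπ h, hne⟩)
      · rfl
  have hinner : ∀ σ : LabelledPartition X,
      ∑ τ : LabelledPartition X, (if π ≤ τ ∧ τ ≤ σ then IncidenceAlgebra.mu ℝ τ σ * σ.m else 0) =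
        if π = σ then σ.m else 0 := by
    intro σ
    rw [← Finset.sum_filter]
    have hIcc : Finset.univ.filter (fun τ => π ≤ τ ∧ τ ≤ σ) = Finset.Icc π σ := by
      ext τ
      simp
    rw [hIcc, ← Finset.sum_mul, IncidenceAlgebra.sum_Icc_mu_left]
    simp
  rw [hsub]
  calc π.m = ∑ σ : LabelledPartition X, if π = σ then σ.m else 0 := by simp
    _ = ∑ σ : LabelledPartition X, ∑ τ : LabelledPartition X,
          if π ≤ τ ∧ τ ≤ σ then IncidenceAlgebra.mu ℝ τ σ * σ.m else 0 :=
        Finset.sum_congr rfl fun σ _ => (hinner σ).symm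
    _ = ∑ τ : LabelledPartition X, ∑ σ : LabelledPartition X,
          if π ≤ τ ∧ τ ≤ σ then IncidenceAlgebra.mu ℝ τ σ * σ.m else 0 := Finset.sum_comm
    _ = ∑ τ : LabelledPartition X, if π ≤ τ then ρ.lam τ else 0 := by
        refine Finset.sum_congr rfl fun τ _ => ?_
        split_ifs with h
        · simp [h, hlam τ h]
        · simp [h]

/-! ### The factorization of the transfer matrix -/

open Classical in
/-- The zeta matrix `([π ≤ τ])` of the reduced state set. -/
noncomputable def zetaMatrix₀ [Finite X] (ρ : LabelledPartition X) :
    Matrix ρ.reducedStates ρ.reducedStates ℝ :=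
  Matrix.of fun π τ => if π ≤ τ then 1 else 0

theorem zetaMatrix₀_isUnit [Finite X] (ρ : LabelledPartition X) : IsUnit ρ.zetaMatrix₀ := by
  classical
  rw [← Matrix.mulVec_injective_iff_isUnit]
  refine (injective_iff_map_eq_zero (Matrix.mulVecLin ρ.zetaMatrix₀)).2 fun v hv => ?_
  funext π
  -- A vector in the kernel vanishes at `π` once it vanishes at all states strictly above `π`.
  induction π using WellFoundedGT.induction with
  | ind π ih =>
    have h := congrFun hv π
    simp only [Matrix.mulVecLin_apply, Matrix.mulVec, dotProduct, zetaMatrix₀, Matrix.of_apply,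
      ite_mul, one_mul, zero_mul, Pi.zero_apply] at h
    rw [Finset.sum_eq_single π] at h
    · simpa using h
    · intro τ _ hne
      split_ifs with hle
      · exact ih τ (lt_of_le_of_ne hle hne.symm)
      · rfl
    · simp

theorem transferMatrix₀_eq [Finite X] (ρ : LabelledPartition X) :
    ρ.transferMatrix₀ =
      ρ.zetaMatrix₀ * Matrix.diagonal (fun τ => ρ.lam τ.1) * ρ.zetaMatrix₀.transpose := by
  classical
  ext π σ
  rw [Matrix.mul_apply]
  simp only [Matrix.mul_diagonal, Matrix.transpose_apply, zetaMatrix₀, transferMatrix₀,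
    Matrix.of_apply]
  rw [m_eq_sum_lam (mem_states_of_le π.2.1 le_sup_left)]
  refine Finset.sum_congr rfl fun τ _ => ?_
  simp only [sup_le_iff, ite_and, ite_mul, mul_ite, one_mul, mul_one, zero_mul, mul_zero,
    Subtype.coe_le_coe]
  split_ifs <;> rfl

theorem transferMatrix₀_isUnit [Finite X] (ρ : LabelledPartition X) :
    IsUnit ρ.transferMatrix₀ := by
  classical
  rw [transferMatrix₀_eq]
  refine (ρ.zetaMatrix₀_isUnit.mul ?_).mul ((Matrix.isUnit_transpose _).2 ρ.zetaMatrix₀_isUnit)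
  rw [Matrix.isUnit_diagonal, Pi.isUnit_iff]
  exact fun τ => isUnit_iff_ne_zero.2 τ.2.2

/-- If `r₁ = Z D b₁` and `r₂ = Z D b₂`, then the bilinear form of `M⁻¹ = (Z D Zᵀ)⁻¹` takes the value
`b₁ᵀ D b₂` at `(r₁, r₂)`. -/
theorem dotProduct_transferMatrix₀_inv_mulVec [Finite X] (ρ : LabelledPartition X)
    (b₁ b₂ : ρ.reducedStates → ℝ) :
    (ρ.zetaMatrix₀.mulVec fun τ => ρ.lam τ.1 * b₁ τ) ⬝ᵥ
        (ρ.transferMatrix₀⁻¹.mulVec (ρ.zetaMatrix₀.mulVec fun τ => ρ.lam τ.1 * b₂ τ)) =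
      ∑ τ, b₁ τ * ρ.lam τ.1 * b₂ τ := by
  classical
  have hZ : IsUnit ρ.zetaMatrix₀.transpose := (Matrix.isUnit_transpose _).2 ρ.zetaMatrix₀_isUnit
  obtain ⟨c, rfl⟩ := (Matrix.mulVec_surjective_iff_isUnit.2 hZ) b₂
  have hr : (ρ.zetaMatrix₀.mulVec fun τ => ρ.lam τ.1 * ρ.zetaMatrix₀.transpose.mulVec c τ) =
      ρ.transferMatrix₀.mulVec c := by
    rw [transferMatrix₀_eq, ← Matrix.mulVec_mulVec, ← Matrix.mulVec_mulVec]
    congr 1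
    ext τ
    rw [Matrix.mulVec_diagonal]
  rw [hr, Matrix.mulVec_mulVec, Matrix.nonsing_inv_mul _
    ((Matrix.isUnit_iff_isUnit_det _).1 ρ.transferMatrix₀_isUnit), Matrix.one_mulVec,
    dotProduct_comm, Matrix.dotProduct_mulVec, ← Matrix.mulVec_transpose, dotProduct_comm,
    dotProduct]
  exact Finset.sum_congr rfl fun τ _ => by ring

/-! ### Labelled partitions induced by connectivity relations -/

/-- The labelled partition that an equivalence relation `s` and a set `T` of terminals induce on
`X`: the blocks are the traces of the classes of `s`, and a block is labelled if its class
contains a terminal. -/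
def induced (s : Setoid α) (T : Set α) (X : Finset α) : LabelledPartition X where
  rel := s.comap Subtype.val
  labelled := {x | ∃ k ∈ T, s k x}
  saturated := fun _ _ hxy ⟨k, hk, hkx⟩ => ⟨k, hk, s.trans' hkx hxy⟩

/-- Each terminal in `T` is equivalent to a vertex of the separator `X`. -/
def Attached (s : Setoid α) (T : Set α) (X : Finset α) : Prop :=
  ∀ k ∈ T, ∃ x ∈ X, s k x

section Gluing

variable {s t : Setoid α} {V₁ V₂ T₁ T₂ : Set α} {X : Finset α}

/-- If `s` lives on `V₁` and `t` on `V₂`, and `V₁` and `V₂` meet in `X` only, then a chain of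
`s`- and `t`-steps between vertices of `X` passes from one relation to the other within `X`. -/
theorem rel_sup_iff (hs : ∀ x y, s x y → x = y ∨ x ∈ V₁ ∧ y ∈ V₁)
    (ht : ∀ x y, t x y → x = y ∨ x ∈ V₂ ∧ y ∈ V₂) (hX : V₁ ∩ V₂ = X) (x y : X) :
    (induced s T₁ X ⊔ induced t T₂ X).rel x y ↔ (s ⊔ t) (x : α) y := by
  set r : Setoid X := (induced s T₁ X ⊔ induced t T₂ X).rel with hr
  have hsr : ∀ a b : X, s (a : α) b → r a b := fun a b h =>
    (le_sup_left : (induced s T₁ X).rel ≤ (induced s T₁ X).rel ⊔ (induced t T₂ X).rel) h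
  have htr : ∀ a b : X, t (a : α) b → r a b := fun a b h =>
    (le_sup_right : (induced t T₂ X).rel ≤ (induced s T₁ X).rel ⊔ (induced t T₂ X).rel) h
  have hmem : ∀ z, z ∈ V₁ → z ∈ V₂ → z ∈ X := fun z h₁ h₂ => by
    have : z ∈ (X : Set α) := hX ▸ ⟨h₁, h₂⟩
    exact this
  constructor
  · have : r ≤ (s ⊔ t).comap Subtype.val :=
      sup_le (fun a b h => (le_sup_left : s ≤ s ⊔ t) h) (fun a b h => (le_sup_right : t ≤ s ⊔ t) h)
    exact fun h => this h
  · -- All vertices reached from `x` are reached by a last step from a vertex of `X` related to `x`.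
    have key : ∀ {a b : α}, Relation.EqvGen (fun u v => s u v ∨ t u v) a b →
        ((∃ w : X, r x w ∧ (s w a ∨ t w a)) ↔ ∃ w : X, r x w ∧ (s w b ∨ t w b)) := by
      have step : ∀ {a b : α}, s a b ∨ t a b → (∃ w : X, r x w ∧ (s w a ∨ t w a)) →
          ∃ w : X, r x w ∧ (s w b ∨ t w b) := by
        rintro a b (hab | hab) ⟨w, hw, hwa | hwa⟩
        · exact ⟨w, hw, Or.inl (s.trans' hwa hab)⟩
        · rcases hs _ _ hab with rfl | ⟨ha, hb⟩
          · exact ⟨w, hw, Or.inr hwa⟩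
          rcases ht _ _ hwa with h | ⟨-, ha'⟩
          · exact ⟨w, hw, Or.inl (h ▸ hab)⟩
          · exact ⟨⟨a, hmem a ha ha'⟩, r.trans' hw (htr _ _ hwa), Or.inl hab⟩
        · rcases ht _ _ hab with rfl | ⟨ha, hb⟩
          · exact ⟨w, hw, Or.inl hwa⟩
          rcases hs _ _ hwa with h | ⟨-, ha'⟩
          · exact ⟨w, hw, Or.inr (h ▸ hab)⟩
          · exact ⟨⟨a, hmem a ha' ha⟩, r.trans' hw (hsr _ _ hwa), Or.inr hab⟩
        · exact ⟨w, hw, Or.inr (t.trans' hwa hab)⟩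
      intro a b hab
      induction hab with
      | rel a b h => exact ⟨step h, step (h.imp s.symm' t.symm')⟩
      | refl => exact Iff.rfl
      | symm a b _ ih => exact ih.symm
      | trans a b c _ _ ih₁ ih₂ => exact ih₁.trans ih₂
    intro h
    rw [Setoid.sup_eq_eqvGen] at h
    obtain ⟨w, hw, hwy | hwy⟩ := (key h).1 ⟨x, r.refl' x, Or.inl (s.refl' x)⟩
    · exact r.trans' hw (hsr _ _ hwy)
    · exact r.trans' hw (htr _ _ hwy)

/-- A terminal that is not equivalent to any vertex of `X` is cut off from the other side. -/
theorem attached_of_forall_rel (hs : ∀ x y, s x y → x = y ∨ x ∈ V₁ ∧ y ∈ V₁)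
    (ht : ∀ x y, t x y → x = y ∨ x ∈ V₂ ∧ y ∈ V₂) (hX : V₁ ∩ V₂ = X) (hT₁ : T₁ ⊆ V₁)
    (hT₂ : T₂ ⊆ V₂) (hne : T₂.Nonempty)
    (h : ∀ u ∈ T₁ ∪ T₂, ∀ v ∈ T₁ ∪ T₂, (s ⊔ t) u v) : Attached s T₁ X := by
  intro k hk
  by_contra! hcon
  have hV : ∀ z, s k z → z ∈ V₁ := fun z hz => (hs _ _ hz).elim (fun e => e ▸ hT₁ hk) (·.2)
  have hV' : ∀ z, s k z → z ∉ V₂ := fun z hz hz₂ =>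
    hcon z (by have : z ∈ (X : Set α) := hX ▸ ⟨hV z hz, hz₂⟩
               exact this) hz
  have key : ∀ {a b : α}, Relation.EqvGen (fun u v => s u v ∨ t u v) a b → (s k a ↔ s k b) := by
    have step : ∀ {a b : α}, s a b ∨ t a b → s k a → s k b := by
      rintro a b (hab | hab) ha
      · exact s.trans' ha hab
      · rcases ht _ _ hab with rfl | ⟨ha₂, -⟩
        · exact ha
        · exact absurd ha₂ (hV' a ha)
    intro a b hab
    induction hab with
    | rel a b h => exact ⟨step h, step (h.imp s.symm' t.symm')⟩
    | refl => exact Iff.rfl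
    | symm a b _ ih => exact ih.symm
    | trans a b c _ _ ih₁ ih₂ => exact ih₁.trans ih₂
  obtain ⟨k', hk'⟩ := hne
  have hkk' := h k (Or.inl hk) k' (Or.inr hk')
  rw [Setoid.sup_eq_eqvGen] at hkk'
  exact hV' k' ((key hkk').1 (s.refl' k)) (hT₂ hk')

open Classical in
/-- Whether the terminals of both sides are connected to each other is determined by the labelled
partitions that the two sides induce on the separator. -/
theorem ite_forall_rel_sup_eq (hs : ∀ x y, s x y → x = y ∨ x ∈ V₁ ∧ y ∈ V₁)
    (ht : ∀ x y, t x y → x = y ∨ x ∈ V₂ ∧ y ∈ V₂) (hX : V₁ ∩ V₂ = X) (hT₁ : T₁ ⊆ V₁)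
    (hT₂ : T₂ ⊆ V₂) (hne₁ : T₁.Nonempty) (hne₂ : T₂.Nonempty) :
    (if ∀ u ∈ T₁ ∪ T₂, ∀ v ∈ T₁ ∪ T₂, (s ⊔ t) u v then 1 else 0 : ℝ) =
      if Attached s T₁ X ∧ Attached t T₂ X then (induced s T₁ X ⊔ induced t T₂ X).m else 0 := by
  have hrel := rel_sup_iff (T₁ := T₁) (T₂ := T₂) hs ht hX
  have hsle : s ≤ s ⊔ t := le_sup_left
  have htle : t ≤ s ⊔ t := le_sup_right
  split_ifs with h ha ha
  · rw [m, if_pos]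
    rw [existsUnique_labelledBlock_iff]
    constructor
    · obtain ⟨k, hk⟩ := hne₁
      obtain ⟨x, hx, hkx⟩ := ha.1 k hk
      exact ⟨⟨x, hx⟩, ⟨x, hx⟩, Or.inl ⟨k, hk, hkx⟩, Setoid.refl' _ _⟩
    · have hlab : ∀ x ∈ (induced s T₁ X ⊔ induced t T₂ X).labelled,
          ∃ k ∈ T₁ ∪ T₂, (s ⊔ t) k (x : α) := by
        rintro x ⟨z, hz, hzx⟩
        have hzx' : (s ⊔ t) (z : α) x := (hrel z x).1 hzx
        rcases hz with ⟨k, hk, hkz⟩ | ⟨k, hk, hkz⟩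
        · exact ⟨k, Or.inl hk, (s ⊔ t).trans' (hsle hkz) hzx'⟩
        · exact ⟨k, Or.inr hk, (s ⊔ t).trans' (htle hkz) hzx'⟩
      intro x hx y hy
      obtain ⟨k, hk, hkx⟩ := hlab x hx
      obtain ⟨l, hl, hly⟩ := hlab y hy
      exact (hrel x y).2 ((s ⊔ t).trans' ((s ⊔ t).symm' hkx) ((s ⊔ t).trans' (h k hk l hl) hly))
  · refine absurd ⟨attached_of_forall_rel hs ht hX hT₁ hT₂ hne₂ h,
      attached_of_forall_rel ht hs (Set.inter_comm V₁ V₂ ▸ hX) hT₂ hT₁ hne₁ ?_⟩ ha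
    rw [Set.union_comm, sup_comm]
    exact h
  · rw [m, if_neg]
    rw [existsUnique_labelledBlock_iff]
    rintro ⟨-, hall⟩
    have hatt : ∀ k ∈ T₁ ∪ T₂, ∃ x ∈ (induced s T₁ X ⊔ induced t T₂ X).labelled,
        (s ⊔ t) k (x : α) := by
      rintro k (hk | hk)
      · obtain ⟨x, hx, hkx⟩ := ha.1 k hk
        exact ⟨⟨x, hx⟩, ⟨⟨x, hx⟩, Or.inl ⟨k, hk, hkx⟩, Setoid.refl' _ _⟩, hsle hkx⟩
      · obtain ⟨x, hx, hkx⟩ := ha.2 k hk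
        exact ⟨⟨x, hx⟩, ⟨⟨x, hx⟩, Or.inr ⟨k, hk, hkx⟩, Setoid.refl' _ _⟩, htle hkx⟩
    refine h fun u hu v hv => ?_
    obtain ⟨x, hx, hux⟩ := hatt u hu
    obtain ⟨y, hy, hvy⟩ := hatt v hv
    exact (s ⊔ t).trans' hux
      ((s ⊔ t).trans' ((hrel x y).1 (hall x hx y hy)) ((s ⊔ t).symm' hvy))
  · rfl

open Classical in
/-- The indicator that all terminals in `T` are attached to `X` and that the induced labelled
partition lies below `τ`. -/
noncomputable def inducedLE (s : Setoid α) (T : Set α) (X : Finset α) (τ : LabelledPartition X) :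
    ℝ :=
  if Attached s T X ∧ induced s T X ≤ τ then 1 else 0

open Classical in
/-- Möbius inversion separates the contributions of the two sides to the connectivity indicator. -/
theorem ite_forall_rel_sup_eq_sum (hs : ∀ x y, s x y → x = y ∨ x ∈ V₁ ∧ y ∈ V₁)
    (ht : ∀ x y, t x y → x = y ∨ x ∈ V₂ ∧ y ∈ V₂) (hX : V₁ ∩ V₂ = X) (hT₁ : T₁ ⊆ V₁)
    (hT₂ : T₂ ⊆ V₂) (hne₁ : T₁.Nonempty) (hne₂ : T₂.Nonempty) {T : Set X}
    (hT : ∀ x ∈ T, (x : α) ∈ T₁) :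
    (if ∀ u ∈ T₁ ∪ T₂, ∀ v ∈ T₁ ∪ T₂, (s ⊔ t) u v then 1 else 0 : ℝ) =
      ∑ τ : (singletons T).reducedStates,
        inducedLE s T₁ X τ * (singletons T).lam τ * inducedLE t T₂ X τ := by
  rw [ite_forall_rel_sup_eq hs ht hX hT₁ hT₂ hne₁ hne₂]
  split_ifs with ha
  · have hst : induced s T₁ X ∈ (singletons T).states := by
      refine ⟨le_iff.2 ⟨bot_le, fun x hx => ⟨x, hT x hx, s.refl' _⟩⟩, ?_⟩
      obtain ⟨k, hk⟩ := hne₁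
      obtain ⟨x, hx, hkx⟩ := ha.1 k hk
      exact (labelledBlocks_nonempty_iff _).2 ⟨⟨x, hx⟩, k, hk, hkx⟩
    rw [m_eq_sum_lam (mem_states_of_le hst le_sup_left)]
    refine Finset.sum_congr rfl fun τ _ => ?_
    simp only [inducedLE, ha.1, ha.2, true_and, sup_le_iff]
    split_ifs <;> simp_all
  · refine (Finset.sum_eq_zero fun τ _ => ?_).symm
    simp only [inducedLE]
    split_ifs <;> simp_all

end Gluing

end LabelledPartition

namespace Graph

variable {α β : Type*}

/-! ### Sums over edge subsets -/

open Classical in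
/-- The probability that, among the edges in `E`, precisely those in `F` are operating. -/
noncomputable def subsetProb (p : β → ℝ) (E F : Finset β) : ℝ :=
  (∏ e ∈ F, p e) * ∏ e ∈ E \ F, (1 - p e)

theorem sum_subsetProb (p : β → ℝ) (E : Finset β) :
    ∑ F ∈ E.powerset, subsetProb p E F = 1 := by
  classical
  have h := Finset.prod_add p (fun e => 1 - p e) E
  simp only [add_sub_cancel, Finset.prod_const_one] at h
  rw [h]
  refine Finset.sum_congr rfl fun F _ => ?_
  rw [subsetProb]

open Classical in
theorem sum_powerset_union_mul_subsetProb (p : β → ℝ) {A B : Finset β} (hAB : Disjoint A B)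
    (f : Finset β → ℝ) :
    ∑ F ∈ (A ∪ B).powerset, f F * subsetProb p (A ∪ B) F =
      ∑ F₁ ∈ A.powerset, ∑ F₂ ∈ B.powerset,
        f (F₁ ∪ F₂) * (subsetProb p A F₁ * subsetProb p B F₂) := by
  rw [← Finset.sum_product']
  symm
  refine Finset.sum_bij' (fun F _ => F.1 ∪ F.2) (fun F _ => (F ∩ A, F ∩ B)) ?_ ?_ ?_ ?_ ?_
  · rintro ⟨F₁, F₂⟩ h
    simp only [Finset.mem_product, Finset.mem_powerset] at h ⊢
    exact Finset.union_subset_union h.1 h.2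
  · intro F _
    simp [Finset.inter_subset_right]
  · rintro ⟨F₁, F₂⟩ h
    simp only [Finset.mem_product, Finset.mem_powerset] at h
    have hd₁ : Disjoint F₁ B := hAB.mono_left h.1
    have hd₂ : Disjoint F₂ A := hAB.symm.mono_left h.2
    simp only [Finset.union_inter_distrib_right, Finset.inter_eq_left.2 h.1,
      Finset.inter_eq_left.2 h.2, Finset.disjoint_iff_inter_eq_empty.1 hd₁,
      Finset.disjoint_iff_inter_eq_empty.1 hd₂, Finset.union_empty, Finset.empty_union]
  · intro F h
    rw [← Finset.inter_union_distrib_left, Finset.inter_eq_left.2 (Finset.mem_powerset.1 h)]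
  · rintro ⟨F₁, F₂⟩ h
    simp only [Finset.mem_product, Finset.mem_powerset] at h
    have hd : (A ∪ B) \ (F₁ ∪ F₂) = (A \ F₁) ∪ (B \ F₂) := by
      ext e
      have h₁ := @h.1 e
      have h₂ := @h.2 e
      have h₃ : e ∈ A → e ∉ B := fun ha hb => Finset.disjoint_left.1 hAB ha hb
      simp only [Finset.mem_sdiff, Finset.mem_union]
      tauto
    simp only [subsetProb]
    rw [hd, Finset.prod_union (hAB.mono h.1 h.2),
      Finset.prod_union (hAB.mono Finset.sdiff_subset Finset.sdiff_subset)]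
    ring

open Classical in
theorem reliability_eq_sum (G : Graph α β) (K : Set α) (p : β → ℝ) {E : Finset β}
    (hE : (E : Set β) = G.edgeSet) :
    G.reliability K p = ∑ F ∈ E.powerset,
      (if (G.restrict (F : Set β)).KConnected K then 1 else 0) * subsetProb p E F := by
  have hpow : 𝒫 G.edgeSet = (E.powerset.image fun F : Finset β => (F : Set β) : Finset (Set β)) := by
    ext F
    rw [← hE, Finset.coe_image, Set.mem_powerset_iff]
    constructor
    · intro hF
      obtain ⟨F', rfl⟩ := Set.Finite.exists_finset_coe (E.finite_toSet.subset hF)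
      exact ⟨F', by simpa using hF, rfl⟩
    · rintro ⟨F', hF', rfl⟩
      simpa using hF'
  rw [reliability, hpow, finsum_mem_coe_finset,
    Finset.sum_image fun _ _ _ _ h => Finset.coe_injective h]
  refine Finset.sum_congr rfl fun F _ => ?_
  rw [edgeProb, subsetProb, ← hE, ← Finset.coe_sdiff, finprod_mem_coe_finset,
    finprod_mem_coe_finset]

open Classical in
/-- The reliability may be computed as a sum over the subsets of any larger set of edges, since the
states of the additional edges do not matter. -/
theorem reliability_eq_sum_of_subset (G : Graph α β) (K : Set α) (p : β → ℝ) {E : Finset β}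
    (hE : G.edgeSet ⊆ E) :
    G.reliability K p = ∑ F ∈ E.powerset,
      (if (G.restrict (F : Set β)).KConnected K then 1 else 0) * subsetProb p E F := by
  obtain ⟨A, hA⟩ := Set.Finite.exists_finset_coe (E.finite_toSet.subset hE)
  have hAE : A ⊆ E := by
    rw [← Finset.coe_subset, hA]
    exact hE
  have hEq : A ∪ (E \ A) = E := Finset.union_sdiff_of_subset hAE
  rw [reliability_eq_sum G K p hA]
  conv_rhs => rw [← hEq]
  rw [sum_powerset_union_mul_subsetProb p Finset.disjoint_sdiff
    fun F => if (G.restrict (F : Set β)).KConnected K then 1 else 0]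
  refine Finset.sum_congr rfl fun F₁ _ => ?_
  have hr : ∀ F₂ ∈ (E \ A).powerset,
      G.restrict ((F₁ ∪ F₂ : Finset β) : Set β) = G.restrict (F₁ : Set β) := by
    intro F₂ hF₂
    rw [← G.restrict_edgeSet_inter, ← G.restrict_edgeSet_inter (F₁ : Set β)]
    congr 1
    rw [← hA, ← Finset.coe_inter, ← Finset.coe_inter, Finset.inter_union_distrib_left,
      Finset.disjoint_iff_inter_eq_empty.1
        (Finset.disjoint_sdiff.mono_right (Finset.mem_powerset.1 hF₂)), Finset.union_empty]
  rw [Finset.sum_congr rfl fun F₂ hF₂ => by rw [hr F₂ hF₂], ← Finset.mul_sum, ← Finset.mul_sum,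
    sum_subsetProb, mul_one]

/-! ### Connectivity relations of graphs -/

/-- The equivalence relation whose classes are the connected components of `G`; points outside of
the vertex set form classes on their own. -/
def reach (G : Graph α β) : Setoid α where
  r := Relation.ReflTransGen G.Adj
  iseqv :=
    { refl := fun _ => Relation.ReflTransGen.refl
      symm := fun h =>
        have : Std.Symm G.Adj := ⟨fun _ _ h => h.symm⟩
        (Relation.ReflTransGen.stdSymm (r := G.Adj)).symm _ _ h
      trans := Relation.ReflTransGen.trans }

theorem reach_le_iff {G : Graph α β} {s : Setoid α} : G.reach ≤ s ↔ ∀ u v, G.Adj u v → s u v := by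
  constructor
  · exact fun h u v huv => h (Relation.ReflTransGen.single huv)
  · intro h u v huv
    induction (show Relation.ReflTransGen G.Adj u v from huv) with
    | refl => exact s.refl' u
    | tail _ hbc ih => exact s.trans' (ih ‹_›) (h _ _ hbc)

theorem eq_or_mem_of_reach {G : Graph α β} (x y : α) (h : G.reach x y) :
    x = y ∨ x ∈ G.vertexSet ∧ y ∈ G.vertexSet := by
  induction (show Relation.ReflTransGen G.Adj x y from h) with
  | refl => exact Or.inl rfl
  | tail hab hbc ih =>
    refine Or.inr ⟨?_, hbc.right_mem⟩
    rcases ih hab with rfl | h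
    · exact hbc.left_mem
    · exact h.1

theorem reach_restrict_eq_sup {G G₁ G₂ : Graph α β} (h₁ : G₁ ≤ G) (h₂ : G₂ ≤ G) {F₁ F₂ : Set β}
    (hF₁ : F₁ ⊆ G₁.edgeSet) (hF₂ : F₂ ⊆ G₂.edgeSet) :
    (G.restrict (F₁ ∪ F₂)).reach = (G₁.restrict F₁).reach ⊔ (G₂.restrict F₂).reach := by
  apply le_antisymm
  · rw [reach_le_iff]
    rintro u v ⟨e, he⟩
    obtain ⟨heF | heF, hl⟩ := he
    · exact (le_sup_left : _ ≤ (G₁.restrict F₁).reach ⊔ _)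
        (Relation.ReflTransGen.single ⟨e, heF, (h₁.isLink_iff (hF₁ heF)).2 hl⟩)
    · exact (le_sup_right : _ ≤ _ ⊔ (G₂.restrict F₂).reach)
        (Relation.ReflTransGen.single ⟨e, heF, (h₂.isLink_iff (hF₂ heF)).2 hl⟩)
  · refine sup_le (reach_le_iff.2 ?_) (reach_le_iff.2 ?_)
    · rintro u v ⟨e, heF, hl⟩
      exact Relation.ReflTransGen.single ⟨e, Or.inl heF, hl.mono h₁⟩
    · rintro u v ⟨e, heF, hl⟩
      exact Relation.ReflTransGen.single ⟨e, Or.inr heF, hl.mono h₂⟩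

/-! ### Merging as a join of equivalence relations -/

section Merge

variable {X : Finset α}

theorem mergeMap_of_mem (π : LabelledPartition X) {v : α} (h : v ∈ X) :
    mergeMap π v = Sum.inr (π.blockOf ⟨v, h⟩) := dif_pos h

theorem mergeMap_of_notMem (π : LabelledPartition X) {v : α} (h : v ∉ X) :
    mergeMap π v = Sum.inl v := dif_neg h

theorem mergeMap_coe_eq_iff (π : LabelledPartition X) (x y : X) :
    mergeMap π x = mergeMap π y ↔ π.rel x y := by
  rw [mergeMap_of_mem π x.2, mergeMap_of_mem π y.2, Sum.inr.injEq]
  exact π.blockOf_eq_blockOf_iff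

theorem eq_or_mem_of_mergeMap_eq (π : LabelledPartition X) (x y : α)
    (h : Setoid.ker (mergeMap π) x y) : x = y ∨ x ∈ (X : Set α) ∧ y ∈ (X : Set α) := by
  replace h : mergeMap π x = mergeMap π y := h
  by_cases hx : x ∈ X <;> by_cases hy : y ∈ X
  · exact Or.inr ⟨hx, hy⟩
  · simp [mergeMap_of_mem π hx, mergeMap_of_notMem π hy] at h
  · simp [mergeMap_of_notMem π hx, mergeMap_of_mem π hy] at h
  · simp only [mergeMap_of_notMem π hx, mergeMap_of_notMem π hy, Sum.inl.injEq] at h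
    exact Or.inl h

theorem induced_ker_mergeMap (π : LabelledPartition X) :
    LabelledPartition.induced (Setoid.ker (mergeMap π)) (Subtype.val '' π.labelled) X = π := by
  refine LabelledPartition.ext ?_ ?_
  · ext x y
    exact mergeMap_coe_eq_iff π x y
  · ext x
    constructor
    · rintro ⟨_, ⟨y, hy, rfl⟩, hyx⟩
      exact π.saturated y x ((mergeMap_coe_eq_iff π y x).1 hyx) hy
    · exact fun hx => ⟨x, ⟨x, hx, rfl⟩, rfl⟩

theorem attached_ker_mergeMap (π : LabelledPartition X) :
    LabelledPartition.Attached (Setoid.ker (mergeMap π)) (Subtype.val '' π.labelled) X := by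
  rintro _ ⟨x, -, rfl⟩
  exact ⟨x, x.2, rfl⟩

theorem mergeTerminals_eq_image (K : Set α) (π : LabelledPartition X) :
    mergeTerminals K π = mergeMap π '' (K ∪ Subtype.val '' π.labelled) := by
  ext z
  constructor
  · rintro (⟨k, ⟨hk, hkX⟩, rfl⟩ | ⟨_, ⟨⟨x, rfl⟩, hl | ⟨_, ⟨y, hy, rfl⟩, hyK⟩⟩, rfl⟩)
    · exact ⟨k, Or.inl hk, mergeMap_of_notMem π hkX⟩
    · exact ⟨x, Or.inr ⟨x, hl.2 (π.rel.refl' x), rfl⟩, mergeMap_of_mem π x.2⟩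
    · refine ⟨y, Or.inl hyK, ?_⟩
      rw [(mergeMap_coe_eq_iff π y x).2 hy]
      exact mergeMap_of_mem π x.2
  · rintro ⟨k, hk | ⟨x, hx, rfl⟩, rfl⟩
    · by_cases hkX : k ∈ X
      · rw [mergeMap_of_mem π hkX]
        exact Or.inr ⟨_, ⟨π.blockOf_mem _, Or.inr ⟨k, ⟨⟨k, hkX⟩, π.rel.refl' _, rfl⟩, hk⟩⟩, rfl⟩
      · rw [mergeMap_of_notMem π hkX]
        exact Or.inl ⟨k, ⟨hk, hkX⟩, rfl⟩
    · rw [mergeMap_of_mem π x.2]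
      exact Or.inr ⟨_, ⟨π.blockOf_mem _, Or.inl (π.blockOf_mem_labelledBlocks hx)⟩, rfl⟩

/-- An edge that is removed by merging has become a loop. -/
theorem merge_isLink_of_ne {H : Graph α β} {π : LabelledPartition X} {e : β} {u v : α}
    (h : H.IsLink e u v) (hne : mergeMap π u ≠ mergeMap π v) :
    (H.merge π).IsLink e (mergeMap π u) (mergeMap π v) := by
  refine ⟨?_, u, v, h, rfl, rfl⟩
  rintro ⟨B, ⟨y, rfl⟩, hB⟩
  obtain ⟨a, ha, rfl⟩ := hB u h.inc_left
  obtain ⟨b, hb, rfl⟩ := hB v h.inc_right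
  exact hne ((mergeMap_coe_eq_iff π a b).2 (π.rel.trans' ha (π.rel.symm' hb)))

/-- Merging according to `π` has the same effect on connectivity as joining the connectivity
relation with the relation `π`. -/
theorem reach_merge_restrict_iff (H : Graph α β) (π : LabelledPartition X) (F : Set β) (u v : α) :
    ((H.merge π).restrict F).reach (mergeMap π u) (mergeMap π v) ↔
      ((H.restrict F).reach ⊔ Setoid.ker (mergeMap π)) u v := by
  have hl : (H.restrict F).reach ≤ (H.restrict F).reach ⊔ Setoid.ker (mergeMap π) := le_sup_left
  have hr : Setoid.ker (mergeMap π) ≤ (H.restrict F).reach ⊔ Setoid.ker (mergeMap π) :=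
    le_sup_right
  constructor
  · intro h
    have key : ∀ {z}, Relation.ReflTransGen ((H.merge π).restrict F).Adj (mergeMap π u) z →
        ∀ w, mergeMap π w = z → ((H.restrict F).reach ⊔ Setoid.ker (mergeMap π)) u w := by
      intro z hz
      induction hz with
      | refl => exact fun w hw => hr hw.symm
      | tail _ hbc ih =>
        intro w hw
        obtain ⟨e, heF, -, a, b, hab, rfl, rfl⟩ := hbc
        exact Setoid.trans' _ (ih a rfl) (Setoid.trans' _
          (hl (Relation.ReflTransGen.single ⟨e, heF, hab⟩)) (hr hw.symm))
    exact key h v rfl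
  · have : (H.restrict F).reach ⊔ Setoid.ker (mergeMap π) ≤
        ((H.merge π).restrict F).reach.comap (mergeMap π) := by
      refine sup_le (reach_le_iff.2 ?_) ?_
      · rintro a b ⟨e, heF, hab⟩
        by_cases hne : mergeMap π a = mergeMap π b
        · rw [Setoid.comap_rel, hne]
        · exact Relation.ReflTransGen.single ⟨e, heF, merge_isLink_of_ne hab hne⟩
      · intro a b hab
        replace hab : mergeMap π a = mergeMap π b := hab
        rw [Setoid.comap_rel, hab]
    exact fun h => this h

theorem kConnected_merge_restrict_iff (H : Graph α β) (K : Set α) (π : LabelledPartition X)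
    (F : Set β) :
    ((H.merge π).restrict F).KConnected (mergeTerminals K π) ↔
      ∀ u ∈ K ∪ Subtype.val '' π.labelled, ∀ v ∈ K ∪ Subtype.val '' π.labelled,
        ((H.restrict F).reach ⊔ Setoid.ker (mergeMap π)) u v := by
  rw [mergeTerminals_eq_image]
  simp only [KConnected, Set.forall_mem_image]
  exact forall₂_congr fun u _ => forall₂_congr fun v _ => reach_merge_restrict_iff H π F u v

end Merge

/-! ### Reliabilities in terms of the reduced states -/

open LabelledPartition

/-- The probability that, in the random spanning subgraph of `H` with edge set contained in `E` (which
stands for the edge set of `H` as a `Finset`), all terminals are attached to `X` and the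
induced labelled partition lies below `τ`. -/
noncomputable def probInducedLE (H : Graph α β) (K : Set α) (X : Finset α) (p : β → ℝ)
    (E : Finset β) (τ : LabelledPartition X) : ℝ :=
  ∑ F ∈ E.powerset, inducedLE (H.restrict (F : Set β)).reach (H.vertexSet ∩ K) X τ *
    subsetProb p E F

/-- The reliabilities of the merged graphs are `Z D b`, where `b` collects the probabilities
`probInducedLE`: the gluing lemmas apply to `H` and the equivalence relation of merging, whose
induced labelled partition is `π` itself. -/
theorem relVector₀_eq (H : Graph α β) (K : Set α) (X : Finset α) (p : β → ℝ) {E : Finset β}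
    (hE : (E : Set β) = H.edgeSet) (hX : (X : Set α) ⊆ H.vertexSet)
    (hne : (H.vertexSet ∩ K).Nonempty) :
    H.relVector₀ K X p = (terminalPartition K X).zetaMatrix₀.mulVec
      fun τ => (terminalPartition K X).lam τ.1 * probInducedLE H K X p E τ.1 := by
  classical
  funext π
  have hsub : (H.merge π.1).edgeSet ⊆ E := by
    rw [hE]
    exact fun e he => he.1
  rw [relVector₀, reliability_eq_sum_of_subset _ _ _ hsub]
  have hexp : ∀ F : Finset β,
      (if ((H.merge π.1).restrict (F : Set β)).KConnected
          (mergeTerminals (H.vertexSet ∩ K) π.1) then 1 else 0 : ℝ) =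
        ∑ τ : (terminalPartition K X).reducedStates,
          inducedLE (H.restrict (F : Set β)).reach (H.vertexSet ∩ K) X τ *
            (terminalPartition K X).lam τ * if π.1 ≤ τ.1 then 1 else 0 := by
    intro F
    rw [if_congr (kConnected_merge_restrict_iff H _ π.1 F) rfl rfl]
    refine (ite_forall_rel_sup_eq_sum (T := {x : X | (x : α) ∈ K}) (V₁ := H.vertexSet)
        (V₂ := X) (eq_or_mem_of_reach (G := H.restrict (F : Set β))) (eq_or_mem_of_mergeMap_eq π.1)
        (Set.inter_eq_right.2 hX) Set.inter_subset_left (by rintro _ ⟨x, -, rfl⟩; exact x.2) hne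
        (((labelledBlocks_nonempty_iff _).1 π.2.1.2).image _) fun x hx => ⟨hX x.2, hx⟩).trans ?_
    refine Finset.sum_congr rfl fun τ _ => ?_
    congr 1
    rw [inducedLE, induced_ker_mergeMap]
    exact if_congr (and_iff_right (attached_ker_mergeMap π.1)) rfl rfl
  simp only [hexp, Matrix.mulVec, dotProduct, zetaMatrix₀, Matrix.of_apply, probInducedLE,
    Finset.sum_mul, Finset.mul_sum]
  rw [Finset.sum_comm]
  refine Finset.sum_congr rfl fun τ _ => Finset.sum_congr rfl fun F _ => ?_
  simp only [Subtype.coe_le_coe]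
  ring

/-- The reliability of `G` is `b₁ᵀ D b₂`: the two sides operate independently, and the connectivity
indicator splits into products for each state `τ`. -/
theorem IsKSplitting.reliability_eq {G G₁ G₂ : Graph α β} {K : Set α} {X : Finset α}
    (h : G.IsKSplitting G₁ G₂ K X) (p : β → ℝ) {E₁ E₂ : Finset β}
    (hE₁ : (E₁ : Set β) = G₁.edgeSet) (hE₂ : (E₂ : Set β) = G₂.edgeSet) :
    G.reliability K p = ∑ τ : (terminalPartition K X).reducedStates,
      probInducedLE G₁ K X p E₁ τ.1 * (terminalPartition K X).lam τ.1 *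
        probInducedLE G₂ K X p E₂ τ.1 := by
  classical
  have hdisj : Disjoint E₁ E₂ := by
    rw [← Finset.disjoint_coe, hE₁, hE₂, Set.disjoint_iff_inter_eq_empty]
    exact h.edgeSet_inter
  have hE : ((E₁ ∪ E₂ : Finset β) : Set β) = G.edgeSet := by
    rw [Finset.coe_union, hE₁, hE₂, h.edgeSet_union]
  have hK : K = (G₁.vertexSet ∩ K) ∪ (G₂.vertexSet ∩ K) := by
    rw [← Set.union_inter_distrib_right, h.vertexSet_union, Set.inter_eq_right.2 h.terminals_subset]
  have hexp : ∀ F₁ ∈ E₁.powerset, ∀ F₂ ∈ E₂.powerset,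
      (if (G.restrict ((F₁ ∪ F₂ : Finset β) : Set β)).KConnected K then 1 else 0 : ℝ) =
        ∑ τ : (terminalPartition K X).reducedStates,
          inducedLE (G₁.restrict (F₁ : Set β)).reach (G₁.vertexSet ∩ K) X τ *
            (terminalPartition K X).lam τ *
              inducedLE (G₂.restrict (F₂ : Set β)).reach (G₂.vertexSet ∩ K) X τ := by
    intro F₁ hF₁ F₂ hF₂
    have hF₁' : (F₁ : Set β) ⊆ G₁.edgeSet :=
      hE₁ ▸ Finset.coe_subset.2 (Finset.mem_powerset.1 hF₁)
    have hF₂' : (F₂ : Set β) ⊆ G₂.edgeSet :=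
      hE₂ ▸ Finset.coe_subset.2 (Finset.mem_powerset.1 hF₂)
    have hX : ∀ x : X, (x : α) ∈ G₁.vertexSet ∩ G₂.vertexSet := fun x => by
      rw [h.vertexSet_inter]
      exact x.2
    refine Eq.trans ?_ (ite_forall_rel_sup_eq_sum (T := {x : X | (x : α) ∈ K}) (V₁ := G₁.vertexSet) (V₂ := G₂.vertexSet)
      (eq_or_mem_of_reach (G := G₁.restrict (F₁ : Set β)))
      (eq_or_mem_of_reach (G := G₂.restrict (F₂ : Set β))) h.vertexSet_inter
      Set.inter_subset_left Set.inter_subset_left h.terminals_left h.terminals_right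
      fun x hx => ⟨(hX x).1, hx⟩)
    rw [← hK, ← reach_restrict_eq_sup h.left_le h.right_le hF₁' hF₂',
      Finset.coe_union]
    rfl
  rw [reliability_eq_sum G K p hE, sum_powerset_union_mul_subsetProb p hdisj
    fun F => if (G.restrict (F : Set β)).KConnected K then 1 else 0]
  rw [Finset.sum_congr rfl fun F₁ hF₁ => Finset.sum_congr rfl fun F₂ hF₂ => by
    rw [hexp F₁ hF₁ F₂ hF₂]]
  simp only [probInducedLE, Finset.sum_mul, Finset.mul_sum]
  rw [Finset.sum_comm' (s' := fun _ => E₁.powerset) (t' := E₂.powerset) (by simp)]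
  rw [Finset.sum_congr rfl fun F₂ _ => Finset.sum_comm, Finset.sum_comm]
  refine Finset.sum_congr rfl fun τ _ => Finset.sum_congr rfl fun F₂ _ =>
    Finset.sum_congr rfl fun F₁ _ => ?_
  ring

end Graph

theorem mainTheorem1 {α β : Type*} (G G₁ G₂ : Graph α β) (K : Set α) (X : Finset α)
    (p : β → ℝ) (hp : ∀ e ∈ G.edgeSet, p e ∈ Set.Icc (0 : ℝ) 1)
    (h : G.IsKSplitting G₁ G₂ K X) :
    IsUnit (Graph.terminalPartition K X).transferMatrix₀ ∧
      G.reliability K p =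
        dotProduct (G₁.relVector₀ K X p)
          (Matrix.mulVec ((Graph.terminalPartition K X).transferMatrix₀)⁻¹
            (G₂.relVector₀ K X p)) := by
  refine ⟨LabelledPartition.transferMatrix₀_isUnit _, ?_⟩
  obtain ⟨E₁, hE₁⟩ := (h.finite_edgeSet.subset h.left_le.edgeSet_mono).exists_finset_coe
  obtain ⟨E₂, hE₂⟩ := (h.finite_edgeSet.subset h.right_le.edgeSet_mono).exists_finset_coe
  have hX₁ : (X : Set α) ⊆ G₁.vertexSet := h.vertexSet_inter ▸ Set.inter_subset_left
  have hX₂ : (X : Set α) ⊆ G₂.vertexSet := h.vertexSet_inter ▸ Set.inter_subset_right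
  rw [Graph.relVector₀_eq G₁ K X p hE₁ hX₁ h.terminals_left,
    Graph.relVector₀_eq G₂ K X p hE₂ hX₂ h.terminals_right,
    LabelledPartition.dotProduct_transferMatrix₀_inv_mulVec, h.reliability_eq p hE₁ hE₂]
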